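/- Let $\mathbb C_+=\{z\in\mathbb C:\operatorname{Im} z>0\}$ and let $m_2$ be two-dimensional Lebesgue measure. For $0<p<\infty$ and $\alpha>-1$ let $A^p_\alpha(\mathbb C_+)$ be the space of all holomorphic functions $f$ on $\mathbb C_+$ with $$\|f\|_{p,\alpha}=\Big(\int_{\mathbb C_+}|f(z)|^p(\operatorname{Im} z)^\alpha\,dm_2(z)\Big)^{1/p}<\infty ,$$ and for $s>0$ let $A^\infty_s(\mathbb C_+)$ be the space of all holomorphic functions $f$ on $\mathbb C_+$ with $$\|f\|_{A^\infty_s}=\sup_{z\in\mathbb C_+}|f(z)|(\operatorname{Im} z)^s<\infty .$$ For $\epsilon>0$ put $V_{\epsilon,t}(f)=\{z\in\mathbb C_+:|f(z)|(\operatorname{Im} z)^t\ge\epsilon\}$. **Theorem.** Let $0<q\le 1$, $\nu>-1$, $t=\frac{\nu+2}{q}$, $\beta>\frac{\nu+2}{q}-2$ and $f\in A^\infty_{\frac{\nu+2}{q}}(\mathbb C_+)$. Then $t_1=t_2$, where $$t_1=\operatorname{dist}_{A^\infty_{\frac{\nu+2}{q}}}(f,A^q_\nu)=\inf_{g\in A^q_\nu(\mathbb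 C_+)}\|f-g\|_{A^\infty_{\frac{\nu+2}{q}}},$$ $$t_2=\inf\left\{\epsilon>0:\int_{\mathbb C_+}\left(\int_{V_{\epsilon,t}(f)}\frac{(\operatorname{Im} w)^{\beta-t}\,dm_2(w)}{|\overline w-z|^{\beta+2}}\right)^q(\operatorname{Im} z)^\nu\,dm_2(z)<\infty\right\}.$$ -/

import Mathlib

open scoped ENNReal ComplexConjugate
open MeasureTheory

noncomputable section

namespace HalfPlane

/-- The open upper half-plane, as a subset of `ℂ`. -/
def upperHalf : Set ℂ := {z : ℂ | 0 < z.im}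

/-- The (quasi)norm `(∫_{ℂ₊} |f(z)|^p (Im z)^α dm₂(z))^{1/p}`, with values in `[0, ∞]`. -/
def bergmanNorm (p α : ℝ) (f : ℂ → ℂ) : ℝ≥0∞ :=
  (∫⁻ z in upperHalf, ENNReal.ofReal (‖f z‖ ^ p * z.im ^ α)) ^ (1 / p)

/-- The weighted Bergman space `A^p_α(ℂ₊)`. Its elements are represented by functions on `ℂ`,
of which only the restriction to the upper half-plane matters. -/
def bergmanSpace (p α : ℝ) : Set (ℂ → ℂ) :=
  {f | DifferentiableOn ℂ f upperHalf ∧ bergmanNorm p α f < ∞}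

/-- The norm `sup_{z ∈ ℂ₊} |f(z)| (Im z)^s`, with values in `[0, ∞]`. -/
def growthNorm (s : ℝ) (f : ℂ → ℂ) : ℝ≥0∞ :=
  ⨆ z ∈ upperHalf, ENNReal.ofReal (‖f z‖ * z.im ^ s)

/-- The space `A^∞_s(ℂ₊)`. -/
def growthSpace (s : ℝ) : Set (ℂ → ℂ) :=
  {f | DifferentiableOn ℂ f upperHalf ∧ growthNorm s f < ∞}

/-- The distance from `f` to the set `X` in the norm of `A^∞_s(ℂ₊)`. -/
def growthDist (s : ℝ) (f : ℂ → ℂ) (X : Set (ℂ → ℂ)) : ℝ≥0∞ :=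
  ⨅ g ∈ X, growthNorm s (f - g)

/-- The level set `V_{ε,t}(f) = {z ∈ ℂ₊ : |f(z)| (Im z)^t ≥ ε}`. -/
def levelSet (ε t : ℝ) (f : ℂ → ℂ) : Set ℂ :=
  {z : ℂ | z ∈ upperHalf ∧ ε ≤ ‖f z‖ * z.im ^ t}

/-- The double integral
`∫_{ℂ₊} (∫_{V_{ε,t}(f)} (Im w)^{β-t} / |conj w - z|^{β+2} dm₂(w))^q (Im z)^ν dm₂(z)`,
with values in `[0, ∞]`. -/
def levelIntegral (q ν β t ε : ℝ) (f : ℂ → ℂ) : ℝ≥0∞ :=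
  ∫⁻ z in upperHalf,
    (∫⁻ w in levelSet ε t f,
      ENNReal.ofReal (w.im ^ (β - t) / ‖conj w - z‖ ^ (β + 2))) ^ q *
    ENNReal.ofReal (z.im ^ ν)

end HalfPlane

end

namespace HalfPlane

open Filter Topology Metric Set

/-! ### Elementary estimates -/

/-! Both sides equal the infimum of the `ε > 0` for which the level set `V_ε(f)` is relatively
compact in the half-plane.

The bridge is the invariant area. Since `t q = ν + 2`, finiteness of the level integral, or
membership in the Bergman space, makes slightly higher level sets of finite invariant area. By
Schwarz's lemma a point of `V_ε'` carries a hyperbolic disc of fixed size inside `V_ε` for `ε < ε'`,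
and a set of finite invariant area holds no such discs far out, so `V_ε'` is relatively compact
(`levelSet_subset_truncation`). Conversely, over a compact set the kernel integral decays like `|z +
i|^{-(β+2)}`, which is enough because `(β + 2) q > ν + 2` (`levelIntegral_lt_top`).

It remains to approximate `f` within `ε + δ` by a Bergman function when `V_ε(f)` is relatively
compact (`growthDist_le`). The Cayley transform turns `f` into a function `F` on the disc whose
weighted size is at most `ε` near the circle. An average of many dilations of `F`, with radii chosen
successively, is bounded and close enough to `F` (`exists_bounded_approx`); pulled back, it decays
like `|z + i|^{-2t}` and so lies in the Bergman space. -/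

theorem rpow_bounds {R x : ℝ} (hR : 1 ≤ R) (h₁ : R⁻¹ ≤ x) (h₂ : x ≤ R) (s : ℝ) :
    R ^ (-|s|) ≤ x ^ s ∧ x ^ s ≤ R ^ |s| := by
  have hR0 : 0 < R := by linarith
  have hx : 0 < x := lt_of_lt_of_le (inv_pos.2 hR0) h₁
  have hlog : |Real.log x| ≤ Real.log R := by
    rw [abs_le, ← Real.log_inv]
    exact ⟨Real.log_le_log (inv_pos.2 hR0) h₁, Real.log_le_log hx h₂⟩
  have hmul : |Real.log x * s| ≤ Real.log R * |s| := by
    rw [abs_mul]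
    exact mul_le_mul_of_nonneg_right hlog (abs_nonneg s)
  rw [abs_le] at hmul
  rw [Real.rpow_def_of_pos hR0, Real.rpow_def_of_pos hx, Real.rpow_def_of_pos hR0]
  constructor <;> apply Real.exp_le_exp.2 <;> linarith [hmul.1, hmul.2]

theorem isOpen_upperHalf : IsOpen upperHalf := isOpen_lt continuous_const Complex.continuous_im

theorem measurableSet_upperHalf : MeasurableSet upperHalf := isOpen_upperHalf.measurableSet

theorem im_mem_of_mem_ball {z w : ℂ} {c : ℝ} (hw : w ∈ ball z (c * z.im)) :
    (1 - c) * z.im < w.im ∧ w.im < (1 + c) * z.im := by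
  rw [mem_ball, dist_eq_norm] at hw
  have h := (Complex.abs_im_le_norm (w - z)).trans_lt hw
  rw [Complex.sub_im, abs_lt] at h
  constructor <;> nlinarith [h.1, h.2]

theorem levelSet_subset_upperHalf (ε t : ℝ) (f : ℂ → ℂ) : levelSet ε t f ⊆ upperHalf :=
  fun _ h => h.1

theorem measurableSet_levelSet {f : ℂ → ℂ} (hf : DifferentiableOn ℂ f upperHalf) (ε t : ℝ) :
    MeasurableSet (levelSet ε t f) := by
  have hc : ContinuousOn (fun z : ℂ => ‖f z‖ * z.im ^ t) upperHalf :=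
    hf.continuousOn.norm.mul (Complex.continuous_im.continuousOn.rpow_const
      fun z hz => Or.inl (ne_of_gt hz))
  obtain ⟨u, hu, hu'⟩ := continuousOn_iff_isClosed.1 hc (Ici ε) isClosed_Ici
  have : levelSet ε t f = u ∩ upperHalf := by
    rw [← hu']
    ext z
    exact and_comm
  rw [this]
  exact hu.measurableSet.inter measurableSet_upperHalf

theorem le_growthNorm {t : ℝ} {f : ℂ → ℂ} (hf : growthNorm t f ≠ ∞) {z : ℂ} (hz : z ∈ upperHalf) :
    ‖f z‖ * z.im ^ t ≤ (growthNorm t f).toReal := by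
  have h : ENNReal.ofReal (‖f z‖ * z.im ^ t) ≤ growthNorm t f :=
    le_iSup₂ (f := fun z (_ : z ∈ upperHalf) => ENNReal.ofReal (‖f z‖ * z.im ^ t)) z hz
  exact (ENNReal.ofReal_le_iff_le_toReal hf).1 h

theorem growthNorm_le {t C : ℝ} {f : ℂ → ℂ} (h : ∀ z ∈ upperHalf, ‖f z‖ * z.im ^ t ≤ C) :
    growthNorm t f ≤ ENNReal.ofReal C :=
  iSup₂_le fun z hz => ENNReal.ofReal_le_ofReal (h z hz)

/-! ### Level sets of functions in the growth space -/

/-- A function in the growth space satisfies a hyperbolic Lipschitz estimate. -/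
theorem exists_hyperbolic_lipschitz {t : ℝ} (ht : 0 < t) {f : ℂ → ℂ} (hf : f ∈ growthSpace t) :
    ∃ A : ℝ, 0 < A ∧ ∀ z ∈ upperHalf, ∀ c : ℝ, 0 < c → c ≤ 1 / 2 → ∀ w ∈ ball z (c * z.im),
      ‖f w - f z‖ * z.im ^ t ≤ A * c := by
  obtain ⟨hd, hn⟩ := hf
  set M := (growthNorm t f).toReal + 1 with hM
  have hM0 : 0 < M := by positivity
  refine ⟨4 * M * 2 ^ t, by positivity, fun z hz c hc hc2 w hw => ?_⟩
  have hy : 0 < z.im := hz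
  have hsub : ball z (z.im / 2) ⊆ upperHalf := fun v hv => by
    have := (im_mem_of_mem_ball (c := 1 / 2) (by rwa [one_div_mul_eq_div])).1
    show 0 < v.im
    linarith
  have hbd : ∀ v ∈ ball z (z.im / 2), ‖f v‖ ≤ M * (z.im / 2) ^ (-t) := fun v hv => by
    have h1 := le_growthNorm hn.ne (hsub hv)
    have h2 := (im_mem_of_mem_ball (z := z) (w := v) (c := 1 / 2) (by rwa [one_div_mul_eq_div])).1
    have h3 : (z.im / 2) ^ t ≤ v.im ^ t :=
      Real.rpow_le_rpow (by positivity) (by linarith) ht.le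
    rw [Real.rpow_neg (by positivity), ← div_eq_mul_inv, le_div_iff₀ (by positivity)]
    calc ‖f v‖ * (z.im / 2) ^ t ≤ ‖f v‖ * v.im ^ t := by gcongr
      _ ≤ M := by linarith
  have hwb : w ∈ ball z (z.im / 2) := ball_subset_ball (by nlinarith) hw
  -- Schwarz's lemma is applied on the disc of radius `Im z / 2`, where `f` stays within twice its
  -- bound of `f z`.
  have hmaps : MapsTo f (ball z (z.im / 2)) (closedBall (f z) (2 * (M * (z.im / 2) ^ (-t)))) :=
    fun v hv => by
      rw [mem_closedBall, dist_eq_norm]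
      have := hbd v hv
      have := hbd z (mem_ball_self (by positivity))
      linarith [norm_sub_le (f v) (f z)]
  have hS := Complex.dist_le_div_mul_dist_of_mapsTo_ball (hd.mono hsub) hmaps hwb
  rw [dist_eq_norm] at hS
  have hw' : dist w z ≤ c * z.im := (mem_ball.1 hw).le
  have hyt : (z.im / 2) ^ (-t) * z.im ^ t = 2 ^ t := by
    rw [Real.rpow_neg (by positivity), Real.div_rpow hy.le (by norm_num)]
    have : z.im ^ t ≠ 0 := (Real.rpow_pos_of_pos hy t).ne'
    field_simp
  calc ‖f w - f z‖ * z.im ^ t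
      ≤ (2 * (M * (z.im / 2) ^ (-t)) / (z.im / 2) * (c * z.im)) * z.im ^ t := by
        gcongr
        exact hS.trans (by gcongr)
    _ = 4 * M * ((z.im / 2) ^ (-t) * z.im ^ t) * c := by field_simp; ring
    _ = 4 * M * 2 ^ t * c := by rw [hyt]

/-- Moving from `z` to `w` costs `A c` by the Lipschitz estimate and a factor `(1 - c)^t` for the
change of height; both losses vanish as `c → 0`. -/
theorem exists_ball_subset_levelSet {t ε ε' : ℝ} (ht : 0 < t) (hε : ε < ε') {f : ℂ → ℂ}
    (hf : f ∈ growthSpace t) :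
    ∃ c : ℝ, 0 < c ∧ c ≤ 1 / 2 ∧ ∀ z ∈ levelSet ε' t f, ball z (c * z.im) ⊆ levelSet ε t f := by
  obtain ⟨A, hA, hlip⟩ := exists_hyperbolic_lipschitz ht hf
  have hcont : Tendsto (fun c : ℝ => (ε' - A * c) * (1 - c) ^ t) (𝓝[>] 0) (𝓝 ε') := by
    have : ContinuousAt (fun c : ℝ => (ε' - A * c) * (1 - c) ^ t) 0 := by
      refine ContinuousAt.mul (by fun_prop) (ContinuousAt.rpow_const (by fun_prop) (Or.inl ?_))
      norm_num
    have h := this.tendsto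
    simp only [mul_zero, sub_zero, Real.one_rpow, mul_one] at h
    exact h.mono_left nhdsWithin_le_nhds
  obtain ⟨c, h1, hc0, hc2⟩ := ((hcont.eventually (lt_mem_nhds hε)).and
    (Ioc_mem_nhdsGT (show (0 : ℝ) < 1 / 2 by norm_num))).exists
  refine ⟨c, hc0, hc2, fun z hz w hw => ?_⟩
  have hy : 0 < z.im := hz.1
  have hwi := (im_mem_of_mem_ball hw).1
  have h2 := hlip z hz.1 c hc0 hc2 w hw
  have hc1 : 0 < 1 - c := by linarith
  have hwpos : 0 < w.im := (mul_pos hc1 hy).trans hwi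
  refine ⟨hwpos, ?_⟩
  have h3 : ε' - A * c ≤ ‖f w‖ * z.im ^ t := by
    have h5 : ‖f z‖ ≤ ‖f w‖ + ‖f w - f z‖ := by
      have := norm_sub_norm_le (f z) (f w)
      rw [norm_sub_rev] at this
      linarith
    have := mul_le_mul_of_nonneg_right h5 (Real.rpow_nonneg hy.le t)
    linarith [hz.2]
  calc ε ≤ (ε' - A * c) * (1 - c) ^ t := h1.le
    _ ≤ ‖f w‖ * z.im ^ t * (1 - c) ^ t := by gcongr
    _ = ‖f w‖ * ((1 - c) * z.im) ^ t := by rw [Real.mul_rpow hc1.le hy.le]; ring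
    _ ≤ ‖f w‖ * w.im ^ t := by gcongr

/-! ### Invariant area and relative compactness -/

/-- The compact sets `{z : R⁻¹ ≤ Im z, |z| ≤ R}` exhausting the half-plane. -/
def truncation (R : ℝ) : Set ℂ := {z : ℂ | R⁻¹ ≤ z.im ∧ ‖z‖ ≤ R}

theorem measurableSet_truncation (R : ℝ) : MeasurableSet (truncation R) :=
  ((isClosed_le continuous_const Complex.continuous_im).inter
    (isClosed_le continuous_norm continuous_const)).measurableSet

theorem truncation_mono {R S : ℝ} (hR : 0 < R) (h : R ≤ S) : truncation R ⊆ truncation S :=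
  fun _ hz => ⟨(inv_anti₀ hR h).trans hz.1, hz.2.trans h⟩

theorem exists_mem_truncation {z : ℂ} (hz : z ∈ upperHalf) : ∃ n : ℕ, z ∈ truncation (n + 1) := by
  obtain ⟨n, hn⟩ := exists_nat_ge (max (z.im⁻¹) ‖z‖)
  have hy : 0 < z.im := hz
  refine ⟨n, ?_, ?_⟩
  · rw [inv_le_comm₀ (by positivity) hy]
    linarith [le_max_left (z.im⁻¹) ‖z‖]
  · linarith [le_max_right (z.im⁻¹) ‖z‖]

theorem mem_truncation_of_ball {R c : ℝ} (hc : c ≤ 1 / 2) {z w : ℂ}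
    (hz : z ∈ upperHalf) (hw : w ∈ ball z (c * z.im)) (hwR : w ∈ truncation R) :
    z ∈ truncation (2 * R) := by
  have hy : 0 < z.im := hz
  obtain ⟨h1, h2⟩ := im_mem_of_mem_ball hw
  obtain ⟨h3, h4⟩ := hwR
  have h5 := (le_abs_self _).trans (Complex.abs_im_le_norm w)
  have hzi : z.im ≤ 2 * R := by nlinarith
  constructor
  · rw [mul_inv]
    nlinarith
  · have h6 : dist w z ≤ c * z.im := (mem_ball.1 hw).le
    rw [dist_eq_norm, norm_sub_rev] at h6
    have h7 := norm_sub_norm_le z w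
    nlinarith

/-- The invariant area `∫_S (Im z)^{-2} dm₂(z)` of a set. -/
noncomputable def invariantArea (S : Set ℂ) : ℝ≥0∞ :=
  ∫⁻ z in S, ENNReal.ofReal (z.im ^ (-2 : ℝ))

/-- What matters is that the bound does not depend on `z`. It comes from `Im w ≤ 2 Im z` on the
ball, with `π` replaced by `1`. -/
theorem invariantArea_ball_ge {z : ℂ} (hz : z ∈ upperHalf) {c : ℝ} (hc : 0 < c) (hc2 : c ≤ 1 / 2) :
    ENNReal.ofReal (c ^ 2 / 4) ≤ invariantArea (ball z (c * z.im)) := by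
  have hy : 0 < z.im := hz
  have h1 : ∀ w ∈ ball z (c * z.im), ENNReal.ofReal ((2 * z.im) ^ (-2 : ℝ)) ≤
      ENNReal.ofReal (w.im ^ (-2 : ℝ)) := fun w hw => by
    obtain ⟨h1, h2⟩ := im_mem_of_mem_ball hw
    apply ENNReal.ofReal_le_ofReal
    exact Real.rpow_le_rpow_of_nonpos (by nlinarith) (by nlinarith) (by norm_num)
  have hpi : (1 : ℝ≥0∞) ≤ NNReal.pi := by
    have : (1 : NNReal) ≤ NNReal.pi := by
      rw [← NNReal.coe_le_coe]
      simpa using (by linarith [Real.pi_gt_three] : (1 : ℝ) ≤ Real.pi)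
    exact_mod_cast this
  calc ENNReal.ofReal (c ^ 2 / 4)
      = ENNReal.ofReal ((2 * z.im) ^ (-2 : ℝ)) * (ENNReal.ofReal (c * z.im) ^ 2 * 1) := by
        rw [mul_one, ← ENNReal.ofReal_pow (by positivity), ← ENNReal.ofReal_mul (by positivity)]
        congr 1
        rw [Real.rpow_neg (by positivity), Real.rpow_two]
        field_simp
        norm_num
    _ ≤ ENNReal.ofReal ((2 * z.im) ^ (-2 : ℝ)) * volume (ball z (c * z.im)) := by
        rw [Complex.volume_ball]
        gcongr
    _ = ∫⁻ w in ball z (c * z.im), ENNReal.ofReal ((2 * z.im) ^ (-2 : ℝ)) := by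
        rw [setLIntegral_const]
    _ ≤ _ := setLIntegral_mono' measurableSet_ball h1

/-- If a level set has finite invariant area, every higher level set is relatively compact. -/
theorem levelSet_subset_truncation {t ε ε' : ℝ} (ht : 0 < t) (hε : ε < ε') {f : ℂ → ℂ}
    (hf : f ∈ growthSpace t) (hfin : invariantArea (levelSet ε t f) < ∞) :
    ∃ R : ℝ, 1 ≤ R ∧ levelSet ε' t f ⊆ truncation R := by
  obtain ⟨c, hc, hc2, hball⟩ := exists_ball_subset_levelSet ht hε hf
  set V := levelSet ε t f
  have hV : MeasurableSet V := measurableSet_levelSet hf.1 ε t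
  set μ : Measure ℂ := (volume.restrict V).withDensity fun z => ENNReal.ofReal (z.im ^ (-2 : ℝ))
  -- These tails decrease to the empty set, so their invariant areas tend to `0` and eventually
  -- leave no room for a hyperbolic disc of size `c`.
  set s : ℕ → Set ℂ := fun n => V \ truncation (n + 1)
  have hs : ∀ n, MeasurableSet (s n) := fun n => hV.diff (measurableSet_truncation _)
  have hanti : Antitone s := fun m n hmn => sdiff_subset_sdiff_right
    (truncation_mono (by positivity) (by gcongr))
  have huniv : μ univ = invariantArea V := by
    rw [withDensity_apply _ MeasurableSet.univ, Measure.restrict_univ, invariantArea]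
  have hlim := tendsto_measure_iInter_atTop (μ := μ) (fun n => (hs n).nullMeasurableSet) hanti
    ⟨0, ((measure_mono (subset_univ _)).trans_lt (huniv ▸ hfin)).ne⟩
  have hempty : ⋂ n, s n = ∅ := by
    refine eq_empty_of_forall_notMem fun z hz => ?_
    rw [mem_iInter] at hz
    obtain ⟨n, hn⟩ := exists_mem_truncation (hz 0).1.1
    exact (hz n).2 hn
  rw [hempty, measure_empty] at hlim
  have hpos : (0 : ℝ≥0∞) < ENNReal.ofReal (c ^ 2 / 4) := ENNReal.ofReal_pos.2 (by positivity)
  obtain ⟨n, hn⟩ := (hlim.eventually (gt_mem_nhds hpos)).exists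
  refine ⟨2 * (n + 1), by linarith [n.cast_nonneg (α := ℝ)], fun z hz => ?_⟩
  by_contra hcon
  have hsub : ball z (c * z.im) ⊆ s n := fun w hw =>
    ⟨hball z hz hw, fun hw' => hcon (mem_truncation_of_ball hc2 hz.1 hw hw')⟩
  have : invariantArea (ball z (c * z.im)) ≤ μ (s n) := by
    rw [withDensity_apply _ (hs n), Measure.restrict_restrict (hs n),
      inter_eq_left.2 (sdiff_subset : s n ⊆ V)]
    exact lintegral_mono_set hsub
  exact absurd (((invariantArea_ball_ge hz.1 hc hc2).trans this).trans_lt hn) (lt_irrefl _)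

/-! ### Approximation in the disc by averages of dilations -/

theorem one_sub_norm_sq_pos {ζ : ℂ} (hζ : ζ ∈ ball (0 : ℂ) 1) : 0 < 1 - ‖ζ‖ ^ 2 := by
  rw [mem_ball_zero_iff] at hζ
  nlinarith [norm_nonneg ζ]

theorem exists_dilation_close {F : ℂ → ℂ} (hF : DifferentiableOn ℂ F (ball 0 1)) {δ η : ℝ}
    (hδ : 0 < δ) (hη : 0 < η) :
    ∃ r : ℝ, 0 < r ∧ r < 1 ∧ ∀ ζ ∈ ball (0 : ℂ) 1, η ≤ 1 - ‖ζ‖ ^ 2 → ‖F ζ - F (r * ζ)‖ ≤ δ := by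
  set K : Set ℂ := {ζ | η ≤ 1 - ‖ζ‖ ^ 2}
  have hKball : K ⊆ ball 0 1 := fun ζ (hζ : η ≤ 1 - ‖ζ‖ ^ 2) => by
    rw [mem_ball_zero_iff]
    nlinarith [norm_nonneg ζ]
  have hK : IsCompact K := by
    refine Metric.isCompact_of_isClosed_isBounded
      (isClosed_le continuous_const (by fun_prop)) (isBounded_ball.subset hKball)
  have huc := hK.uniformContinuousOn_of_continuous (hF.continuousOn.mono hKball)
  rw [Metric.uniformContinuousOn_iff] at huc
  obtain ⟨d, hd, h⟩ := huc δ hδ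
  -- The second entry keeps `ζ` and `r ζ` closer than `d`; the first only keeps `r` positive.
  set r := max (1 / 2) (1 - d / 2)
  have hr0 : 0 < r := lt_of_lt_of_le (by norm_num) (le_max_left _ _)
  have hr1 : r < 1 := max_lt (by norm_num) (by linarith)
  refine ⟨r, hr0, hr1, fun ζ hζ hζη => ?_⟩
  have hn : ‖(r : ℂ) * ζ‖ = r * ‖ζ‖ := by
    rw [norm_mul, Complex.norm_real, Real.norm_of_nonneg hr0.le]
  have hζ1 : ‖ζ‖ < 1 := mem_ball_zero_iff.1 hζ
  have hmem : (r : ℂ) * ζ ∈ K := by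
    show η ≤ 1 - ‖(r : ℂ) * ζ‖ ^ 2
    have : r * ‖ζ‖ ≤ ‖ζ‖ := by nlinarith [norm_nonneg ζ]
    have : (r * ‖ζ‖) ^ 2 ≤ ‖ζ‖ ^ 2 := by gcongr
    rw [hn]
    linarith
  have := h ζ hζη _ hmem (by
    have : ζ - r * ζ = ((1 - r : ℝ) : ℂ) * ζ := by push_cast; ring
    rw [dist_eq_norm, this, norm_mul, Complex.norm_real, Real.norm_of_nonneg (by linarith)]
    have : 1 - d / 2 ≤ r := le_max_right _ _
    nlinarith [norm_nonneg ζ])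
  rw [dist_eq_norm] at this
  exact this.le

/-- The point is that `2 * M` does not grow with `N`. The new dilation is accurate except in a
boundary layer so thin that the bounded sum `S` is negligible there. In that layer the error is
bounded afresh, so the loss of order `M` is paid once rather than at each step. -/
theorem exists_bounded_sum_dilations {t M L η δ : ℝ} (ht : 0 < t) (hη : 0 < η) (hδ : 0 < δ)
    (hL : 0 ≤ L) {F : ℂ → ℂ} (hF : DifferentiableOn ℂ F (ball 0 1))
    (hM : ∀ ζ ∈ ball (0 : ℂ) 1, ‖F ζ‖ * (1 - ‖ζ‖ ^ 2) ^ t ≤ M)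
    (hFL : ∀ ζ ∈ ball (0 : ℂ) 1, 1 - ‖ζ‖ ^ 2 < η → ‖F ζ‖ * (1 - ‖ζ‖ ^ 2) ^ t ≤ L) (N : ℕ) :
    ∃ S : ℂ → ℂ, DifferentiableOn ℂ S (ball 0 1) ∧ (∃ B, ∀ ζ ∈ ball (0 : ℂ) 1, ‖S ζ‖ ≤ B) ∧
      ∀ ζ ∈ ball (0 : ℂ) 1, ‖N * F ζ - S ζ‖ * (1 - ‖ζ‖ ^ 2) ^ t ≤ N * (L + δ) + 2 * M := by
  have hM0 : 0 ≤ M := by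
    have := hM 0 (mem_ball_self one_pos)
    simp only [norm_zero, zero_pow two_ne_zero, sub_zero, Real.one_rpow, mul_one] at this
    exact (norm_nonneg _).trans this
  induction N with
  | zero =>
    refine ⟨0, differentiableOn_const 0, ⟨0, by simp⟩, fun ζ _ => ?_⟩
    simp [hM0]
  | succ N ih =>
    obtain ⟨S, hSd, ⟨B, hB⟩, hS⟩ := ih
    obtain ⟨η', hη'0, hη'η, hη'B⟩ : ∃ η' : ℝ, 0 < η' ∧ η' ≤ η ∧ (|B|) * η' ^ t ≤ δ := by
      have hc : Tendsto (fun x : ℝ => |B| * x ^ t) (𝓝[>] 0) (𝓝 0) := by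
        have : ContinuousAt (fun x : ℝ => |B| * x ^ t) 0 :=
          continuousAt_const.mul (continuousAt_id.rpow_const (Or.inr ht.le))
        have h := this.tendsto
        simp only [Real.zero_rpow ht.ne', mul_zero] at h
        exact h.mono_left nhdsWithin_le_nhds
      obtain ⟨x, h1, h2, h3⟩ := ((hc.eventually (gt_mem_nhds hδ)).and (Ioc_mem_nhdsGT hη)).exists
      exact ⟨x, h2, h3, h1.le⟩
    obtain ⟨r, hr0, hr1, hr⟩ := exists_dilation_close hF hδ hη'0
    have hnorm : ∀ ζ : ℂ, ‖(r : ℂ) * ζ‖ = r * ‖ζ‖ := fun ζ => by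
      rw [norm_mul, Complex.norm_real, Real.norm_of_nonneg hr0.le]
    have hmaps : ∀ ζ ∈ ball (0 : ℂ) 1, (r : ℂ) * ζ ∈ ball (0 : ℂ) 1 := fun ζ hζ => by
      rw [mem_ball_zero_iff] at hζ ⊢
      rw [hnorm]
      nlinarith [norm_nonneg ζ]
    have hle : ∀ ζ : ℂ, (r * ‖ζ‖) ^ 2 ≤ ‖ζ‖ ^ 2 := fun ζ => by
      have : r * ‖ζ‖ ≤ ‖ζ‖ := by nlinarith [norm_nonneg ζ]
      gcongr
    have hr2 : 0 < 1 - r ^ 2 := by nlinarith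
    refine ⟨fun ζ => S ζ + F (r * ζ), ?_, ⟨B + M / (1 - r ^ 2) ^ t, fun ζ hζ => ?_⟩,
      fun ζ hζ => ?_⟩
    · exact hSd.add (hF.comp (by fun_prop) hmaps)
    · have h1 := hM _ (hmaps ζ hζ)
      rw [hnorm] at h1
      have h2 : (1 - r ^ 2) ^ t ≤ (1 - (r * ‖ζ‖) ^ 2) ^ t := by
        refine Real.rpow_le_rpow hr2.le ?_ ht.le
        have : r * ‖ζ‖ ≤ r := by nlinarith [norm_nonneg ζ, mem_ball_zero_iff.1 hζ]
        have : (r * ‖ζ‖) ^ 2 ≤ r ^ 2 := by gcongr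
        linarith
      have h3 : ‖F (r * ζ)‖ ≤ M / (1 - r ^ 2) ^ t := by
        rw [le_div_iff₀ (by positivity)]
        exact le_trans (by gcongr) h1
      exact (norm_add_le _ _).trans (add_le_add (hB ζ hζ) h3)
    · have hs := one_sub_norm_sq_pos hζ
      set ω := (1 - ‖ζ‖ ^ 2) ^ t with hω
      have hω0 : 0 ≤ ω := by positivity
      have hω1 : ω ≤ 1 := Real.rpow_le_one hs.le (by nlinarith [norm_nonneg ζ]) ht.le
      have hcast : ((N + 1 : ℕ) : ℝ) * (L + δ) + 2 * M = N * (L + δ) + 2 * M + (L + δ) := by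
        push_cast; ring
      rw [hcast]
      -- Away from the layer the new term adds at most `δ` to the inductive error; inside it the
      -- inductive bound is discarded and each term is estimated separately.
      rcases le_or_gt η' (1 - ‖ζ‖ ^ 2) with h | h
      · have h1 := hr ζ hζ h
        have h2 : ‖((N + 1 : ℕ) : ℂ) * F ζ - (S ζ + F (r * ζ))‖ ≤
            ‖N * F ζ - S ζ‖ + ‖F ζ - F (r * ζ)‖ := by
          refine le_trans (le_of_eq ?_) (norm_add_le _ _)
          congr 1
          push_cast; ring
        have h3 : ‖F ζ - F (r * ζ)‖ * ω ≤ δ := by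
          nlinarith [norm_nonneg (F ζ - F (r * ζ))]
        have h4 := mul_le_mul_of_nonneg_right h2 hω0
        have h5 := hS ζ hζ
        rw [← hω] at h5
        linarith
      · have h1 := hFL ζ hζ (by linarith)
        have h2 := hM ζ hζ
        have h3 : ‖F (r * ζ)‖ * ω ≤ M := by
          refine le_trans ?_ (hM _ (hmaps ζ hζ))
          rw [hω, hnorm]
          have := hle ζ
          gcongr
        have h4 : ‖S ζ‖ * ω ≤ δ := by
          refine le_trans ?_ hη'B
          have := (hB ζ hζ).trans (le_abs_self B)
          rw [hω]
          gcongr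
        have h5 : ‖((N + 1 : ℕ) : ℂ) * F ζ - (S ζ + F (r * ζ))‖ ≤
            N * ‖F ζ‖ + ‖F ζ‖ + ‖S ζ‖ + ‖F (r * ζ)‖ := by
          calc _ = ‖(N * F ζ + F ζ) - (S ζ + F (r * ζ))‖ := by push_cast; ring_nf
            _ ≤ ‖(N : ℂ) * F ζ + F ζ‖ + ‖S ζ + F (r * ζ)‖ := norm_sub_le _ _
            _ ≤ (‖(N : ℂ) * F ζ‖ + ‖F ζ‖) + (‖S ζ‖ + ‖F (r * ζ)‖) :=
                add_le_add (norm_add_le _ _) (norm_add_le _ _)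
            _ = _ := by rw [norm_mul, Complex.norm_natCast]; ring
        have h6 := mul_le_mul_of_nonneg_right h5 hω0
        have h7 : N * (‖F ζ‖ * ω) ≤ N * L := by gcongr
        have h8 : (0 : ℝ) ≤ N * δ := by positivity
        nlinarith

/-- A holomorphic function on the disc of growth `O((1 - |ζ|²)^{-t})` can be approximated by bounded
holomorphic functions up to the upper limit of `|F(ζ)| (1 - |ζ|²)^t` at the boundary. -/
theorem exists_bounded_approx {t M L η δ : ℝ} (ht : 0 < t) (hη : 0 < η) (hδ : 0 < δ)
    (hL : 0 ≤ L) {F : ℂ → ℂ} (hF : DifferentiableOn ℂ F (ball 0 1))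
    (hM : ∀ ζ ∈ ball (0 : ℂ) 1, ‖F ζ‖ * (1 - ‖ζ‖ ^ 2) ^ t ≤ M)
    (hFL : ∀ ζ ∈ ball (0 : ℂ) 1, 1 - ‖ζ‖ ^ 2 < η → ‖F ζ‖ * (1 - ‖ζ‖ ^ 2) ^ t ≤ L) :
    ∃ G : ℂ → ℂ, DifferentiableOn ℂ G (ball 0 1) ∧ (∃ B, ∀ ζ ∈ ball (0 : ℂ) 1, ‖G ζ‖ ≤ B) ∧
      ∀ ζ ∈ ball (0 : ℂ) 1, ‖F ζ - G ζ‖ * (1 - ‖ζ‖ ^ 2) ^ t ≤ L + δ := by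
  -- After division by `N` the error is `L + δ / 2 + 2 M / N`, and this choice makes the last term
  -- at most `δ / 2`.
  obtain ⟨N, hN⟩ := exists_nat_gt (4 * |M| / δ)
  have hN0 : (0 : ℝ) < N := lt_of_le_of_lt (by positivity) hN
  obtain ⟨S, hSd, ⟨B, hB⟩, hS⟩ := exists_bounded_sum_dilations ht hη (half_pos hδ) hL hF hM hFL N
  have hNC : (N : ℂ) ≠ 0 := by exact_mod_cast hN0.ne'
  refine ⟨fun ζ => (N : ℂ)⁻¹ * S ζ, hSd.const_mul _, ⟨(N : ℝ)⁻¹ * B, fun ζ hζ => ?_⟩,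
    fun ζ hζ => ?_⟩
  · rw [norm_mul, norm_inv, Complex.norm_natCast]
    have := hB ζ hζ
    gcongr
  · have h1 : F ζ - (N : ℂ)⁻¹ * S ζ = (N : ℂ)⁻¹ * (N * F ζ - S ζ) := by field_simp
    have h2 := hS ζ hζ
    rw [div_lt_iff₀ hδ] at hN
    rw [h1, norm_mul, norm_inv, Complex.norm_natCast, mul_assoc, inv_mul_le_iff₀ hN0]
    nlinarith [le_abs_self M]

/-! ### Integral estimates -/

theorem lintegral_rpow_mul_one_add_rpow_lt_top {ν b : ℝ} (hν : -1 < ν) (hb : ν + 1 < b) :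
    ∫⁻ y in Ioi (0 : ℝ), ENNReal.ofReal (y ^ ν * (1 + y) ^ (-b)) < ∞ := by
  have h0 : IntegrableOn (fun y : ℝ => y ^ ν) (Ioc 0 1) :=
    (intervalIntegrable_iff_integrableOn_Ioc_of_le zero_le_one).1
      (intervalIntegral.intervalIntegrable_rpow' hν)
  have h1 : IntegrableOn (fun y : ℝ => y ^ (ν - b)) (Ioi 1) :=
    integrableOn_Ioi_rpow_of_lt (by linarith) one_pos
  rw [← Ioc_union_Ioi_eq_Ioi (zero_le_one' ℝ)]
  refine (lintegral_union_le _ _ _).trans_lt (ENNReal.add_lt_top.2 ⟨?_, ?_⟩)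
  · refine lt_of_le_of_lt (setLIntegral_mono' measurableSet_Ioc fun y hy => ?_) h0.lintegral_lt_top
    apply ENNReal.ofReal_le_ofReal
    have h2 : (1 + y) ^ (-b) ≤ 1 :=
      Real.rpow_le_one_of_one_le_of_nonpos (by linarith [hy.1]) (by linarith)
    exact mul_le_of_le_one_right (Real.rpow_nonneg hy.1.le _) h2
  · refine lt_of_le_of_lt (setLIntegral_mono' measurableSet_Ioi fun y hy => ?_) h1.lintegral_lt_top
    have hy0 : 0 < y := one_pos.trans hy
    apply ENNReal.ofReal_le_ofReal
    rw [sub_eq_add_neg, Real.rpow_add hy0]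
    have : (1 + y) ^ (-b) ≤ y ^ (-b) :=
      Real.rpow_le_rpow_of_nonpos hy0 (by linarith) (by linarith)
    gcongr

theorem one_le_norm_add_I {z : ℂ} (hz : z ∈ upperHalf) :
    1 + z.im ≤ ‖z + Complex.I‖ ∧ 1 + |z.re| ≤ 2 * ‖z + Complex.I‖ := by
  have hy : 0 < z.im := hz
  have h1 := (le_abs_self _).trans (Complex.abs_im_le_norm (z + Complex.I))
  have h2 := Complex.abs_re_le_norm (z + Complex.I)
  simp only [Complex.add_im, Complex.I_im, Complex.add_re, Complex.I_re, add_zero] at h1 h2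
  constructor <;> linarith

theorem lintegral_im_rpow_mul_norm_rpow_lt_top {ν a : ℝ} (hν : -1 < ν) (ha : ν + 2 < a) :
    ∫⁻ z in upperHalf, ENNReal.ofReal (z.im ^ ν * ‖z + Complex.I‖ ^ (-a)) < ∞ := by
  -- The decay is split between the variables: `1 + d` suffices for integrability in `x`, and `ν + 1
  -- + d` in `y`.
  obtain ⟨d, hd, rfl⟩ : ∃ d : ℝ, 0 < d ∧ a = (1 + d) + (ν + 1 + d) :=
    ⟨(a - ν - 2) / 2, by linarith, by ring⟩
  set g₁ : ℝ → ℝ≥0∞ := fun x => ENNReal.ofReal ((2 : ℝ)⁻¹ ^ (-(1 + d)) * (1 + ‖x‖) ^ (-(1 + d)))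
  set g₂ : ℝ → ℝ≥0∞ := (Ioi 0).indicator
    fun y => ENNReal.ofReal (y ^ ν * (1 + y) ^ (-(ν + 1 + d)))
  have hm₁ : Measurable g₁ := by fun_prop
  have hm₂ : Measurable g₂ := Measurable.indicator (by fun_prop) measurableSet_Ioi
  have hi₁ : ∫⁻ x, g₁ x < ∞ := by
    have : Integrable (fun x : ℝ => (1 + ‖x‖) ^ (-(1 + d))) :=
      integrable_one_add_norm (by simpa using hd)
    exact (this.const_mul _).lintegral_lt_top
  have hi₂ : ∫⁻ y, g₂ y < ∞ := by
    rw [lintegral_indicator measurableSet_Ioi]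
    exact lintegral_rpow_mul_one_add_rpow_lt_top hν (by linarith)
  have hle : ∀ z ∈ upperHalf,
      ENNReal.ofReal (z.im ^ ν * ‖z + Complex.I‖ ^ (-((1 + d) + (ν + 1 + d)))) ≤
        g₁ z.re * g₂ z.im := fun z hz => by
    have hy : 0 < z.im := hz
    obtain ⟨h1, h2⟩ := one_le_norm_add_I hz
    have hpos : 0 < ‖z + Complex.I‖ := by linarith
    have h3 : ‖z + Complex.I‖ ^ (-(ν + 1 + d)) ≤ (1 + z.im) ^ (-(ν + 1 + d)) :=
      Real.rpow_le_rpow_of_nonpos (by linarith) h1 (by linarith)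
    have h4 : ‖z + Complex.I‖ ^ (-(1 + d)) ≤ (2 : ℝ)⁻¹ ^ (-(1 + d)) * (1 + ‖z.re‖) ^ (-(1 + d)) := by
      rw [← Real.mul_rpow (by norm_num) (by positivity), Real.norm_eq_abs]
      exact Real.rpow_le_rpow_of_nonpos (by positivity) (by linarith) (by linarith)
    simp only [g₁, g₂]
    rw [indicator_of_mem (show z.im ∈ Ioi 0 from hy), ← ENNReal.ofReal_mul (by positivity)]
    apply ENNReal.ofReal_le_ofReal
    rw [neg_add, Real.rpow_add hpos]
    calc z.im ^ ν * (‖z + Complex.I‖ ^ (-(1 + d)) * ‖z + Complex.I‖ ^ (-(ν + 1 + d)))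
        ≤ z.im ^ ν * (((2 : ℝ)⁻¹ ^ (-(1 + d)) * (1 + ‖z.re‖) ^ (-(1 + d))) *
            (1 + z.im) ^ (-(ν + 1 + d))) := by gcongr
      _ = _ := by ring
  calc _ ≤ ∫⁻ z in upperHalf, g₁ z.re * g₂ z.im := setLIntegral_mono' measurableSet_upperHalf hle
    _ ≤ ∫⁻ z : ℂ, g₁ z.re * g₂ z.im := setLIntegral_le_lintegral _ _
    _ = ∫⁻ p : ℝ × ℝ, g₁ p.1 * g₂ p.2 :=
        Complex.volume_preserving_equiv_real_prod.lintegral_comp_emb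
          Complex.measurableEquivRealProd.measurableEmbedding (fun p : ℝ × ℝ => g₁ p.1 * g₂ p.2)
    _ = (∫⁻ x, g₁ x) * ∫⁻ y, g₂ y := by
        rw [Measure.volume_eq_prod]
        exact lintegral_prod_mul hm₁.aemeasurable hm₂.aemeasurable
    _ < ∞ := ENNReal.mul_lt_top hi₁ hi₂

theorem lintegral_rpow_lt_top_of_le {q ν a C : ℝ} (hq : 0 < q) (hν : -1 < ν) (ha : ν + 2 < a * q)
    (hC : 0 ≤ C) {u : ℂ → ℝ≥0∞}
    (hu : ∀ z ∈ upperHalf, u z ≤ ENNReal.ofReal (C * ‖z + Complex.I‖ ^ (-a))) :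
    ∫⁻ z in upperHalf, u z ^ q * ENNReal.ofReal (z.im ^ ν) < ∞ := by
  calc ∫⁻ z in upperHalf, u z ^ q * ENNReal.ofReal (z.im ^ ν)
      ≤ ∫⁻ z in upperHalf, ENNReal.ofReal (C ^ q) *
          ENNReal.ofReal (z.im ^ ν * ‖z + Complex.I‖ ^ (-(a * q))) := by
        refine setLIntegral_mono' measurableSet_upperHalf fun z hz => ?_
        have hy : 0 < z.im := hz
        calc u z ^ q * ENNReal.ofReal (z.im ^ ν)
            ≤ ENNReal.ofReal (C * ‖z + Complex.I‖ ^ (-a)) ^ q * ENNReal.ofReal (z.im ^ ν) := by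
              gcongr
              exact hu z hz
          _ = _ := by
              rw [ENNReal.ofReal_rpow_of_nonneg (by positivity) hq.le,
                ← ENNReal.ofReal_mul (by positivity), ← ENNReal.ofReal_mul (by positivity),
                Real.mul_rpow hC (by positivity), ← Real.rpow_mul (norm_nonneg _), neg_mul]
              congr 1
              ring
    _ = ENNReal.ofReal (C ^ q) *
          ∫⁻ z in upperHalf, ENNReal.ofReal (z.im ^ ν * ‖z + Complex.I‖ ^ (-(a * q))) :=
        lintegral_const_mul' _ _ ENNReal.ofReal_ne_top
    _ < ∞ := ENNReal.mul_lt_top ENNReal.ofReal_lt_top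
        (lintegral_im_rpow_mul_norm_rpow_lt_top hν ha)

theorem bergmanNorm_lt_top {q ν a B : ℝ} (hq : 0 < q) (hν : -1 < ν) (ha : ν + 2 < a * q)
    {g : ℂ → ℂ} (hB : 0 ≤ B) (hg : ∀ z ∈ upperHalf, ‖g z‖ ≤ B * ‖z + Complex.I‖ ^ (-a)) :
    bergmanNorm q ν g < ∞ := by
  have h := lintegral_rpow_lt_top_of_le hq hν ha hB (u := fun z => ENNReal.ofReal ‖g z‖)
    fun z hz => ENNReal.ofReal_le_ofReal (hg z hz)
  refine ENNReal.rpow_lt_top_of_nonneg (by positivity) (ne_of_lt (lt_of_le_of_lt ?_ h))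
  refine lintegral_mono fun z => ?_
  simp only
  rw [ENNReal.ofReal_rpow_of_nonneg (norm_nonneg _) hq.le, ← ENNReal.ofReal_mul (by positivity)]

theorem kernel_bound {R : ℝ} (hR : 1 ≤ R) {b : ℝ} (hb : 0 < b) {w z : ℂ}
    (hw : w ∈ truncation R) (hz : z ∈ upperHalf) :
    1 / ‖conj w - z‖ ^ b ≤ (1 + R * (R + 1)) ^ b * ‖z + Complex.I‖ ^ (-b) := by
  have hR0 : 0 < R := by linarith
  have hy : 0 < z.im := hz
  have h1 : R⁻¹ ≤ ‖conj w - z‖ := by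
    have := (neg_le_abs _).trans (Complex.abs_im_le_norm (conj w - z))
    simp only [Complex.sub_im, Complex.conj_im] at this
    linarith [hw.1]
  have h2 : 0 < ‖conj w - z‖ := lt_of_lt_of_le (inv_pos.2 hR0) h1
  have h3 : 0 < ‖z + Complex.I‖ := by linarith [(one_le_norm_add_I hz).1]
  have h4 : ‖z + Complex.I‖ ≤ ‖conj w - z‖ + (R + 1) := by
    have e : z + Complex.I = (conj w + Complex.I) - (conj w - z) := by ring
    have e1 := norm_sub_le (conj w + Complex.I) (conj w - z)
    have e2 := norm_add_le (conj w) Complex.I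
    rw [Complex.norm_conj, Complex.norm_I] at e2
    rw [e]
    linarith [hw.2]
  -- The additive error `R + 1` is absorbed using `1 ≤ R |conj w - z|`.
  have h5 : ‖z + Complex.I‖ ≤ (1 + R * (R + 1)) * ‖conj w - z‖ := by
    have : 1 ≤ R * ‖conj w - z‖ := by
      rwa [inv_le_iff_one_le_mul₀' hR0] at h1
    nlinarith
  rw [Real.rpow_neg h3.le, ← div_eq_mul_inv, div_le_div_iff₀ (by positivity) (by positivity),
    one_mul, ← Real.mul_rpow (by positivity) h2.le]
  exact Real.rpow_le_rpow h3.le h5 hb.le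

theorem volume_truncation_lt_top (R : ℝ) : volume (truncation R) < ∞ :=
  lt_of_le_of_lt (measure_mono fun _ hz => mem_closedBall_zero_iff.2 hz.2)
    (measure_closedBall_lt_top (x := (0 : ℂ)) (r := R))

theorem levelIntegral_lt_top {q ν t β ε R : ℝ} (hq : 0 < q) (hν : -1 < ν)
    (hβ : ν + 2 < (β + 2) * q) (hR : 1 ≤ R) {f : ℂ → ℂ} (hsub : levelSet ε t f ⊆ truncation R) :
    levelIntegral q ν β t ε f < ∞ := by
  have hb : 0 < β + 2 := by
    by_contra h
    nlinarith
  set C := R ^ |β - t| * (1 + R * (R + 1)) ^ (β + 2)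
  have hC : 0 ≤ C := by positivity
  refine lintegral_rpow_lt_top_of_le hq hν hβ (C := C * (volume (truncation R)).toReal)
    (by positivity) fun z hz => ?_
  calc ∫⁻ w in levelSet ε t f, ENNReal.ofReal (w.im ^ (β - t) / ‖conj w - z‖ ^ (β + 2))
      ≤ ∫⁻ w in truncation R, ENNReal.ofReal (w.im ^ (β - t) / ‖conj w - z‖ ^ (β + 2)) :=
        lintegral_mono_set hsub
    _ ≤ ∫⁻ w in truncation R, ENNReal.ofReal (C * ‖z + Complex.I‖ ^ (-(β + 2))) := by
        refine setLIntegral_mono' (measurableSet_truncation R) fun w hw => ?_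
        apply ENNReal.ofReal_le_ofReal
        have h1 := (rpow_bounds hR hw.1 (((le_abs_self _).trans
          (Complex.abs_im_le_norm w)).trans hw.2) (β - t)).2
        calc w.im ^ (β - t) / ‖conj w - z‖ ^ (β + 2)
            = w.im ^ (β - t) * (1 / ‖conj w - z‖ ^ (β + 2)) := by ring
          _ ≤ R ^ |β - t| * ((1 + R * (R + 1)) ^ (β + 2) * ‖z + Complex.I‖ ^ (-(β + 2))) :=
              mul_le_mul h1 (kernel_bound hR hb hw hz) (by positivity) (by positivity)
          _ = _ := by ring
    _ = ENNReal.ofReal (C * (volume (truncation R)).toReal * ‖z + Complex.I‖ ^ (-(β + 2))) := by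
        rw [setLIntegral_const]
        nth_rw 1 [← ENNReal.ofReal_toReal (volume_truncation_lt_top R).ne]
        rw [← ENNReal.ofReal_mul (by positivity)]
        congr 1
        ring

/-! ### From integrability to finite invariant area -/

/-- On the ball `Im w` and `|conj w - z|` are comparable to `Im z`, so the integrand has size `(Im
z)^{-t-2}` on an area of order `(Im z)^2`. -/
theorem inner_integral_ge {t β c : ℝ} (hb : 0 < β + 2) (hc : 0 < c) (hc2 : c ≤ 1 / 2) {z : ℂ}
    (hz : z ∈ upperHalf) {S : Set ℂ} (hS : ball z (c * z.im) ⊆ S) :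
    ENNReal.ofReal (2 ^ (-|β - t|) / 3 ^ (β + 2) * c ^ 2 * z.im ^ (-t)) ≤
      ∫⁻ w in S, ENNReal.ofReal (w.im ^ (β - t) / ‖conj w - z‖ ^ (β + 2)) := by
  have hy : 0 < z.im := hz
  have hle : ∀ w ∈ ball z (c * z.im),
      ENNReal.ofReal (2 ^ (-|β - t|) * z.im ^ (β - t) / (3 * z.im) ^ (β + 2)) ≤
        ENNReal.ofReal (w.im ^ (β - t) / ‖conj w - z‖ ^ (β + 2)) := fun w hw => by
    obtain ⟨h1, h2⟩ := im_mem_of_mem_ball hw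
    have hw0 : 0 < w.im := by nlinarith
    have h3 : (2 : ℝ) ^ (-|β - t|) ≤ (w.im / z.im) ^ (β - t) := by
      refine (rpow_bounds one_le_two ?_ ?_ _).1
      · rw [le_div_iff₀ hy]; nlinarith
      · rw [div_le_iff₀ hy]; nlinarith
    rw [Real.div_rpow hw0.le hy.le, le_div_iff₀ (by positivity)] at h3
    have h4 : 0 < ‖conj w - z‖ := by
      have := (neg_le_abs _).trans (Complex.abs_im_le_norm (conj w - z))
      simp only [Complex.sub_im, Complex.conj_im] at this
      linarith
    have h5 : ‖conj w - z‖ ≤ 3 * z.im := by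
      have e : conj w - z = conj (w - z) - (2 * z.im : ℝ) * Complex.I := by
        rw [map_sub]
        apply Complex.ext <;> simp
        ring
      have e1 := norm_sub_le (conj (w - z)) ((2 * z.im : ℝ) * Complex.I)
      rw [Complex.norm_conj, norm_mul, Complex.norm_I, mul_one, Complex.norm_real,
        Real.norm_of_nonneg (by positivity)] at e1
      have e2 : ‖w - z‖ ≤ c * z.im := by
        rw [← dist_eq_norm]
        exact (mem_ball.1 hw).le
      rw [e]
      nlinarith
    apply ENNReal.ofReal_le_ofReal
    gcongr
  have hpi : (1 : ℝ≥0∞) ≤ NNReal.pi := by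
    have : (1 : NNReal) ≤ NNReal.pi := by
      rw [← NNReal.coe_le_coe]
      simpa using (by linarith [Real.pi_gt_three] : (1 : ℝ) ≤ Real.pi)
    exact_mod_cast this
  calc ENNReal.ofReal (2 ^ (-|β - t|) / 3 ^ (β + 2) * c ^ 2 * z.im ^ (-t))
      = ENNReal.ofReal (2 ^ (-|β - t|) * z.im ^ (β - t) / (3 * z.im) ^ (β + 2)) *
          (ENNReal.ofReal (c * z.im) ^ 2 * 1) := by
        rw [mul_one, ← ENNReal.ofReal_pow (by positivity), ← ENNReal.ofReal_mul (by positivity)]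
        congr 1
        have : z.im ^ (β - t) = z.im ^ (-t) * z.im ^ (β + 2) / z.im ^ 2 := by
          rw [← Real.rpow_add hy, ← Real.rpow_two, ← Real.rpow_sub hy]
          congr 1
          ring
        rw [this, Real.mul_rpow (by norm_num) hy.le]
        have := (Real.rpow_pos_of_pos hy (β + 2)).ne'
        field_simp
    _ ≤ ENNReal.ofReal (2 ^ (-|β - t|) * z.im ^ (β - t) / (3 * z.im) ^ (β + 2)) *
          volume (ball z (c * z.im)) := by
        rw [Complex.volume_ball]
        gcongr
    _ = ∫⁻ w in ball z (c * z.im),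
          ENNReal.ofReal (2 ^ (-|β - t|) * z.im ^ (β - t) / (3 * z.im) ^ (β + 2)) := by
        rw [setLIntegral_const]
    _ ≤ ∫⁻ w in ball z (c * z.im), ENNReal.ofReal (w.im ^ (β - t) / ‖conj w - z‖ ^ (β + 2)) :=
        setLIntegral_mono' measurableSet_ball hle
    _ ≤ _ := lintegral_mono_set hS

theorem invariantArea_lt_top_of_le {D : ℝ} (hD : 0 < D) {S : Set ℂ} (hSm : MeasurableSet S)
    (hS : S ⊆ upperHalf) {u : ℂ → ℝ≥0∞}
    (hu : ∀ z ∈ S, ENNReal.ofReal (D * z.im ^ (-2 : ℝ)) ≤ u z)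
    (hfin : ∫⁻ z in upperHalf, u z < ∞) : invariantArea S < ∞ := by
  have h : ENNReal.ofReal D * invariantArea S < ∞ := by
    rw [invariantArea, ← lintegral_const_mul' _ _ ENNReal.ofReal_ne_top]
    refine lt_of_le_of_lt ((setLIntegral_mono' hSm fun z hz => ?_).trans
      (lintegral_mono_set hS)) hfin
    rw [← ENNReal.ofReal_mul hD.le]
    exact hu z hz
  exact ENNReal.lt_top_of_mul_ne_top_right h.ne (ENNReal.ofReal_pos.2 hD).ne'

/-- On the higher level set the outer integrand is at least a constant times `(Im z)^{-tq+ν} = (Im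
z)^{-2}`. -/
theorem invariantArea_levelSet_lt_top_of_levelIntegral {q ν t β ε ε' : ℝ} (hq : 0 < q)
    (ht : 0 < t) (htq : t * q = ν + 2) (hb : 0 < β + 2) (hε : ε < ε') {f : ℂ → ℂ}
    (hf : f ∈ growthSpace t) (hfin : levelIntegral q ν β t ε f < ∞) :
    invariantArea (levelSet ε' t f) < ∞ := by
  obtain ⟨c, hc, hc2, hball⟩ := exists_ball_subset_levelSet ht hε hf
  set K : ℝ := 2 ^ (-|β - t|) / 3 ^ (β + 2) * c ^ 2
  have hK : 0 < K := by positivity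
  refine invariantArea_lt_top_of_le (D := K ^ q) (by positivity) (measurableSet_levelSet hf.1 _ _)
    (levelSet_subset_upperHalf _ _ _) (fun z hz => ?_) hfin
  have hy : 0 < z.im := hz.1
  refine le_trans (le_of_eq ?_) (mul_le_mul_left (ENNReal.rpow_le_rpow
    (inner_integral_ge (t := t) hb hc hc2 hz.1 (hball z hz)) hq.le) _)
  rw [ENNReal.ofReal_rpow_of_nonneg (by positivity) hq.le, ← ENNReal.ofReal_mul (by positivity),
    Real.mul_rpow hK.le (by positivity), ← Real.rpow_mul hy.le, mul_assoc, ← Real.rpow_add hy]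
  congr 3
  linarith

/-- This is Chebyshev's inequality: `|g|^q (Im z)^ν = (|g| (Im z)^t)^q (Im z)^{-2}`. -/
theorem invariantArea_levelSet_lt_top_of_bergmanSpace {q ν t ε : ℝ} (hq : 0 < q)
    (htq : t * q = ν + 2) (hε : 0 < ε) {g : ℂ → ℂ} (hg : g ∈ bergmanSpace q ν) :
    invariantArea (levelSet ε t g) < ∞ := by
  obtain ⟨hd, hn⟩ := hg
  rw [bergmanNorm, ENNReal.rpow_lt_top_iff_of_pos (by positivity)] at hn
  refine invariantArea_lt_top_of_le (D := ε ^ q) (by positivity) (measurableSet_levelSet hd _ _)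
    (levelSet_subset_upperHalf _ _ _) (fun z hz => ?_) hn
  have hy : 0 < z.im := hz.1
  apply ENNReal.ofReal_le_ofReal
  calc ε ^ q * z.im ^ (-2 : ℝ) ≤ (‖g z‖ * z.im ^ t) ^ q * z.im ^ (-2 : ℝ) := by
        gcongr
        exact hz.2
    _ = ‖g z‖ ^ q * z.im ^ ν := by
        rw [Real.mul_rpow (norm_nonneg _) (by positivity), ← Real.rpow_mul hy.le, mul_assoc,
          ← Real.rpow_add hy]
        congr 2
        linarith

/-! ### Transfer to the disc by the Cayley transform -/

/-- The Cayley transform, from the half-plane to the disc. -/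
noncomputable def cayley (z : ℂ) : ℂ := (z - Complex.I) / (z + Complex.I)

/-- The inverse Cayley transform, from the disc to the half-plane. -/
noncomputable def cayleyInv (ζ : ℂ) : ℂ := Complex.I * (1 + ζ) / (1 - ζ)

theorem add_I_ne_zero {z : ℂ} (hz : z ∈ upperHalf) : z + Complex.I ≠ 0 := by
  have h := (one_le_norm_add_I hz).1
  have hy : 0 < z.im := hz
  exact norm_pos_iff.1 (by linarith)

theorem one_sub_ne_zero {ζ : ℂ} (hζ : ζ ∈ ball (0 : ℂ) 1) : 1 - ζ ≠ 0 := by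
  rintro h
  rw [sub_eq_zero] at h
  simp [← h] at hζ

theorem one_sub_mem_slitPlane {ζ : ℂ} (hζ : ζ ∈ ball (0 : ℂ) 1) : 1 - ζ ∈ Complex.slitPlane := by
  refine Or.inl ?_
  have := (Complex.re_le_norm ζ).trans_lt (mem_ball_zero_iff.1 hζ)
  simpa using this

theorem im_cayleyInv {ζ : ℂ} (hζ : ζ ∈ ball (0 : ℂ) 1) :
    (cayleyInv ζ).im = (1 - ‖ζ‖ ^ 2) / ‖1 - ζ‖ ^ 2 := by
  rw [cayleyInv, Complex.div_im, Complex.sq_norm, Complex.sq_norm]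
  have : Complex.normSq (1 - ζ) ≠ 0 := by simpa using one_sub_ne_zero hζ
  rw [← sub_div, Complex.normSq_apply ζ]
  congr 1
  simp
  ring

theorem cayleyInv_mem {ζ : ℂ} (hζ : ζ ∈ ball (0 : ℂ) 1) : cayleyInv ζ ∈ upperHalf := by
  show 0 < (cayleyInv ζ).im
  rw [im_cayleyInv hζ]
  have := one_sub_norm_sq_pos hζ
  have := norm_pos_iff.2 (one_sub_ne_zero hζ)
  positivity

theorem cayleyInv_cayley {z : ℂ} (hz : z ∈ upperHalf) : cayleyInv (cayley z) = z := by
  have h := add_I_ne_zero hz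
  rw [cayleyInv, cayley]
  have h1 : 1 - (z - Complex.I) / (z + Complex.I) = 2 * Complex.I / (z + Complex.I) := by
    field_simp; ring
  have h2 : 1 + (z - Complex.I) / (z + Complex.I) = 2 * z / (z + Complex.I) := by
    field_simp; ring
  rw [h1, h2]
  field_simp [Complex.I_ne_zero]

theorem norm_one_sub_cayley {z : ℂ} (hz : z ∈ upperHalf) :
    ‖1 - cayley z‖ = 2 / ‖z + Complex.I‖ := by
  have h := add_I_ne_zero hz
  have h1 : 1 - cayley z = 2 * Complex.I / (z + Complex.I) := by
    rw [cayley]; field_simp; ring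
  rw [h1, norm_div, norm_mul, Complex.norm_I, Complex.norm_ofNat, mul_one]

theorem one_sub_norm_sq_cayley {z : ℂ} (hz : z ∈ upperHalf) :
    1 - ‖cayley z‖ ^ 2 = z.im * ‖1 - cayley z‖ ^ 2 := by
  have h := norm_pos_iff.2 (add_I_ne_zero hz)
  rw [norm_one_sub_cayley hz, cayley, norm_div, div_pow, div_pow, eq_comm, ← mul_div_assoc,
    div_eq_iff (by positivity), sub_mul, div_mul_cancel₀ _ (by positivity), Complex.sq_norm,
    Complex.sq_norm, Complex.normSq_apply, Complex.normSq_apply]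
  simp
  ring

theorem cayley_mem {z : ℂ} (hz : z ∈ upperHalf) : cayley z ∈ ball (0 : ℂ) 1 := by
  have hy : 0 < z.im := hz
  have h1 := one_sub_norm_sq_cayley hz
  have h2 : 0 < ‖1 - cayley z‖ := by
    rw [norm_one_sub_cayley hz]
    have := norm_pos_iff.2 (add_I_ne_zero hz)
    positivity
  have h3 : 0 < z.im * ‖1 - cayley z‖ ^ 2 := by positivity
  rw [mem_ball_zero_iff]
  nlinarith [norm_nonneg (cayley z)]

theorem one_sub_norm_sq_rpow {s t : ℝ} {ζ : ℂ} (hs : 0 ≤ s) (h : 1 - ‖ζ‖ ^ 2 = s * ‖1 - ζ‖ ^ 2) :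
    (1 - ‖ζ‖ ^ 2) ^ t = s ^ t * ‖1 - ζ‖ ^ (2 * t) := by
  rw [h, Real.mul_rpow hs (by positivity), Real.rpow_mul (norm_nonneg _), Real.rpow_two]

theorem growthDist_le {q ν t ε : ℝ} (hq : 0 < q) (hν : -1 < ν) (ht : 0 < t)
    (htq : t * q = ν + 2) (hε : 0 < ε) {R : ℝ} (hR : 1 ≤ R) {f : ℂ → ℂ} (hf : f ∈ growthSpace t)
    (hsub : levelSet ε t f ⊆ truncation R) {δ : ℝ} (hδ : 0 < δ) :
    growthDist t f (bergmanSpace q ν) ≤ ENNReal.ofReal (ε + δ) := by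
  -- The factor compensates for `Im z = (1 - |ζ|²) / |1 - ζ|²`, so the weighted sizes of `F` and `f`
  -- agree exactly.
  set F : ℂ → ℂ := fun ζ => f (cayleyInv ζ) * (1 - ζ) ^ ((-(2 * t) : ℝ) : ℂ) with hFdef
  have hFd : DifferentiableOn ℂ F (ball 0 1) := by
    refine (hf.1.comp ?_ fun ζ hζ => cayleyInv_mem hζ).mul
      (DifferentiableOn.cpow (by fun_prop) (by fun_prop) fun ζ hζ => one_sub_mem_slitPlane hζ)
    exact DifferentiableOn.div (by fun_prop) (by fun_prop) fun ζ hζ => one_sub_ne_zero hζ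
  have hFn : ∀ ζ ∈ ball (0 : ℂ) 1,
      ‖F ζ‖ * (1 - ‖ζ‖ ^ 2) ^ t = ‖f (cayleyInv ζ)‖ * (cayleyInv ζ).im ^ t := fun ζ hζ => by
    have h0 := norm_pos_iff.2 (one_sub_ne_zero hζ)
    rw [one_sub_norm_sq_rpow (s := (cayleyInv ζ).im) (le_of_lt (cayleyInv_mem hζ))
      (by rw [im_cayleyInv hζ, div_mul_cancel₀ _ (by positivity)]), hFdef, norm_mul,
      Complex.norm_cpow_real, Real.rpow_neg h0.le]
    have := (Real.rpow_pos_of_pos h0 (2 * t)).ne'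
    field_simp
  -- On the truncation `1 - |ζ|² = 4 Im z / |z + i|²` is at least this number, so `|F|` has weighted
  -- size at most `ε` in the layer beyond it.
  have hη : 0 < R⁻¹ * (2 / (R + 1)) ^ 2 := by positivity
  obtain ⟨G, hGd, ⟨B, hB⟩, hG⟩ := exists_bounded_approx ht hη hδ hε.le hFd
    (M := (growthNorm t f).toReal)
    (fun ζ hζ => by
      rw [hFn ζ hζ]
      exact le_growthNorm hf.2.ne (cayleyInv_mem hζ))
    (fun ζ hζ hζη => by
      rw [hFn ζ hζ]
      by_contra hcon
      have hmem := hsub ⟨cayleyInv_mem hζ, (not_le.1 hcon).le⟩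
      refine absurd hζη (not_lt.2 ?_)
      have hz := cayleyInv_mem hζ
      have h1 : ζ = cayley (cayleyInv ζ) := by
        have h2 := one_sub_ne_zero hζ
        have h3 : cayleyInv ζ - Complex.I = 2 * Complex.I * ζ / (1 - ζ) := by
          rw [cayleyInv]; field_simp; ring
        have h4 : cayleyInv ζ + Complex.I = 2 * Complex.I / (1 - ζ) := by
          rw [cayleyInv]; field_simp; ring
        rw [cayley, h3, h4]
        field_simp [Complex.I_ne_zero]
      rw [h1, one_sub_norm_sq_cayley hz, norm_one_sub_cayley hz]
      have h5 : ‖cayleyInv ζ + Complex.I‖ ≤ R + 1 := by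
        refine (norm_add_le _ _).trans ?_
        rw [Complex.norm_I]
        linarith [hmem.2]
      have h6 := norm_pos_iff.2 (add_I_ne_zero hz)
      have h7 := hmem.1
      have h8 : 0 < (cayleyInv ζ).im := hz
      gcongr)
  set g : ℂ → ℂ := fun z => G (cayley z) * (1 - cayley z) ^ ((2 * t : ℝ) : ℂ) with hgdef
  have hcd : DifferentiableOn ℂ cayley upperHalf :=
    DifferentiableOn.div (by fun_prop) (by fun_prop) fun z hz => add_I_ne_zero hz
  have hgd : DifferentiableOn ℂ g upperHalf :=
    (hGd.comp hcd fun z hz => cayley_mem hz).mul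
      (DifferentiableOn.cpow ((differentiableOn_const 1).sub hcd) (by fun_prop)
        fun z hz => one_sub_mem_slitPlane (cayley_mem hz))
  have hgn : bergmanNorm q ν g < ∞ := by
    -- The factor `(1 - cayley z)^{2t}` supplies decay of order `2t`, and `2 t q = 2 (ν + 2) > ν +
    -- 2`.
    refine bergmanNorm_lt_top (a := 2 * t) (B := |B| * 2 ^ (2 * t)) hq hν (by nlinarith)
      (by positivity) fun z hz => ?_
    have h6 := norm_pos_iff.2 (add_I_ne_zero hz)
    rw [hgdef, norm_mul, Complex.norm_cpow_real, norm_one_sub_cayley hz,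
      Real.div_rpow (by norm_num) h6.le, Real.rpow_neg h6.le, mul_assoc, ← div_eq_mul_inv]
    have := (hB _ (cayley_mem hz)).trans (le_abs_self B)
    gcongr
  refine (iInf₂_le g ⟨hgd, hgn⟩).trans (growthNorm_le fun z hz => ?_)
  have hy : 0 < z.im := hz
  have hc := cayley_mem hz
  have h0 := norm_pos_iff.2 (one_sub_ne_zero hc)
  have hfz : f z = F (cayley z) * (1 - cayley z) ^ ((2 * t : ℝ) : ℂ) := by
    rw [hFdef]
    simp only
    rw [cayleyInv_cayley hz, mul_assoc, ← Complex.cpow_add _ _ (one_sub_ne_zero hc)]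
    simp
  refine le_trans (le_of_eq ?_) (hG _ hc)
  rw [Pi.sub_apply, hfz, hgdef, ← sub_mul, norm_mul, Complex.norm_cpow_real,
    one_sub_norm_sq_rpow hy.le (one_sub_norm_sq_cayley hz)]
  ring

/-! ### The two inequalities -/

theorem growthDist_le_of_levelIntegral {q ν t β ε : ℝ} (hq : 0 < q) (hν : -1 < ν) (ht : 0 < t)
    (htq : t * q = ν + 2) (hb : 0 < β + 2) {f : ℂ → ℂ} (hf : f ∈ growthSpace t) (hε : 0 < ε)
    (hfin : levelIntegral q ν β t ε f < ∞) :
    growthDist t f (bergmanSpace q ν) ≤ ENNReal.ofReal ε := by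
  refine ENNReal.le_of_forall_pos_le_add fun δ hδ _ => ?_
  have hδ' : (0 : ℝ) < δ := hδ
  -- The level is raised twice, first for finite area and then for compactness; the remaining `δ /
  -- 2` is the approximation error.
  have h₁ := invariantArea_levelSet_lt_top_of_levelIntegral (ε' := ε + δ / 4) hq ht htq hb
    (by linarith) hf hfin
  obtain ⟨R, hR, hsub⟩ := levelSet_subset_truncation (ε' := ε + δ / 2) ht (by linarith) hf h₁
  refine (growthDist_le hq hν ht htq (by linarith) hR hf hsub (half_pos hδ')).trans (le_of_eq ?_)
  rw [add_assoc, add_halves, ENNReal.ofReal_add hε.le hδ'.le, ENNReal.ofReal_coe_nnreal]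

theorem levelIntegral_lt_top_of_growthNorm_sub {q ν t β ε : ℝ} (hq : 0 < q) (hν : -1 < ν)
    (ht : 0 < t) (htq : t * q = ν + 2) (hβ : ν + 2 < (β + 2) * q) {f g : ℂ → ℂ}
    (hf : f ∈ growthSpace t) (hg : g ∈ bergmanSpace q ν)
    (hε : growthNorm t (f - g) < ENNReal.ofReal ε) :
    levelIntegral q ν β t ε f < ∞ := by
  have hn : growthNorm t (f - g) ≠ ∞ := (hε.trans ENNReal.ofReal_lt_top).ne
  set m := (growthNorm t (f - g)).toReal
  have hm : m < ε := (ENNReal.lt_ofReal_iff_toReal_lt hn).1 hε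
  -- The compactness argument for `g` needs its Lipschitz estimate, hence the growth bound inherited
  -- from `f` and `f - g`.
  have hgs : g ∈ growthSpace t := by
    refine ⟨hg.1, lt_of_le_of_lt (growthNorm_le (C := (growthNorm t f).toReal + m)
      fun z hz => ?_) ENNReal.ofReal_lt_top⟩
    have h1 := le_growthNorm hf.2.ne hz
    have h2 := le_growthNorm hn hz
    have h3 : ‖g z‖ ≤ ‖f z‖ + ‖(f - g) z‖ := by
      have := norm_sub_le (f z) ((f - g) z)
      rwa [Pi.sub_apply, sub_sub_cancel] at this
    have := mul_le_mul_of_nonneg_right h3 (Real.rpow_nonneg (le_of_lt hz) t)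
    linarith
  obtain ⟨R, hR, hsub⟩ := levelSet_subset_truncation (ε := (ε - m) / 2) (ε' := ε - m) ht
    (by linarith) hgs
    (invariantArea_levelSet_lt_top_of_bergmanSpace hq htq (by linarith) hg)
  -- Subtracting `g` changes the weighted size by at most `m`, so `V_ε(f)` lies in `V_{ε-m}(g)`.
  refine levelIntegral_lt_top hq hν hβ hR fun z hz => hsub ⟨hz.1, ?_⟩
  have h2 := le_growthNorm hn hz.1
  have h3 : ‖f z‖ ≤ ‖g z‖ + ‖(f - g) z‖ := by
    have := norm_add_le (g z) ((f - g) z)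
    rwa [Pi.sub_apply, add_sub_cancel] at this
  have := mul_le_mul_of_nonneg_right h3 (Real.rpow_nonneg (le_of_lt hz.1) t)
  linarith [hz.2]

end HalfPlane

theorem theorem2p6 (q ν t β : ℝ) (hq0 : 0 < q) (hq1 : q ≤ 1) (hν : -1 < ν)
    (ht : t = (ν + 2) / q) (hβ : (ν + 2) / q - 2 < β)
    (f : ℂ → ℂ) (hf : f ∈ HalfPlane.growthSpace ((ν + 2) / q)) :
    HalfPlane.growthDist ((ν + 2) / q) f (HalfPlane.bergmanSpace q ν) =
      ⨅ (ε : ℝ) (_ : 0 < ε ∧ HalfPlane.levelIntegral q ν β t ε f < ∞), ENNReal.ofReal ε := by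
  rw [← ht] at hβ hf ⊢
  have htq : t * q = ν + 2 := by rw [ht, div_mul_cancel₀ _ hq0.ne']
  have ht0 : 0 < t := by rw [ht]; exact div_pos (by linarith) hq0
  apply le_antisymm
  · exact le_iInf₂ fun ε hε => HalfPlane.growthDist_le_of_levelIntegral hq0 hν ht0 htq
      (by linarith) hf hε.1 hε.2
  · refine le_iInf₂ fun g hg => le_of_forall_gt fun c hc => ?_
    obtain ⟨ε, hε0, hε, hεc⟩ := ENNReal.lt_iff_exists_real_btwn.1 hc
    refine lt_of_le_of_lt (iInf₂_le ε ⟨ENNReal.ofReal_pos.1 (pos_of_gt hε), ?_⟩) hεc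
    exact HalfPlane.levelIntegral_lt_top_of_growthNorm_sub hq0 hν ht0 htq (by nlinarith) hf hg hε
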